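/- Let $n,q,p,s\ge 0$ be integers, let $E,A\in\mathbb R^{n\times n}$ with $\operatorname{rank}E=r<n$, $B_w\in\mathbb R^{n\times q}$, $C\in\mathbb R^{p\times n}$, $D_w\in\mathbb R^{p\times q}$, and let $M_A,M_B\in\mathbb R^{n\times s}$, $M_C,M_D\in\mathbb R^{p\times s}$, $N_A,N_C\in\mathbb R^{s\times n}$, $N_B,N_D\in\mathbb R^{s\times q}$. For $\Delta\in\mathbb R^{s\times s}$ with $\Delta^{\mathsf T}\Delta\le I_s$ consider the discrete-time descriptor system $$E x(k+1)=A_\Delta x(k)+B_\Delta w(k),\qquad y(k)=C_\Delta x(k)+D_\Delta w(k),$$ $$A_\Delta=A+M_A\Delta N_A,\quad B_\Delta=B_w+M_B\Delta N_B,\quad C_\Delta=C+M_C\Delta N_C,\quad D_\Delta=D_w+M_D\Delta N_D,$$ with transfer function $P_\Delta(z)=C_\Delta(zE-A_\Delta)^{-1}B_\Delta+D_\Delta$. It is called admissible if it is regular ($\det(\lambda E-A_\Delta)\ne0$ for some $\lambda\in\mathbb C$), causal ($\deg\det(\lambda E-A_\Delta)=\operatorname{rank}E$) and stable (every complex zero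 of $\det(zE-A_\Delta)$ has modulus less than $1$). Write $\|P\|_\infty=\sup_{|z|>1}\overline\sigma(P(z))$, where $\overline\sigma$ is the maximal singular value (for an admissible system this equals $\sup_{\omega\in\mathbb R}\overline\sigma(P(e^{i\omega}))$). Let $\overline W,\overline V\in\mathbb R^{n\times n}$ be nonsingular with $\overline W E\overline V=\operatorname{diag}(I_r,0)$, and put $A_d=\overline WA\overline V$, $B_d=\overline WB_w$, $C_d=C\overline V$, $D_d=D_w$, $M_A^d=\overline WM_A$, $M_B^d=\overline WM_B$, $N_A^d=N_A\overline V$, $N_C^d=N_C\overline V$. Let $\gamma>0$. Suppose that there exist a scalar $\varepsilon>0$ and matrices $L,Q\in\mathbb R^{r\times r}$ with $L=L^{\mathsf T}>0$, $R\in\mathbb R^{r\times(n-r)}$, $S\in\mathbb R^{(n-r)\times(n-r)}$ such that $$\begin{bmatrix}\Sigma+\varepsilon N_1^{\mathsf T}N_1&M_1\\M_1^{\mathsf T}&-\varepsilon I_{4s}\end{bmatrix}<0,$$ where, with $\Gamma=\begin{bmatrix}Q&R\end{bmatrix}$, $\Pi=\begin{bmatrix}0&0\\0&S\end{bmatrix}$,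 $\Theta=\begin{bmatrix}L&0\\0&0\end{bmatrix}$, $\Sigma_{11}=-\frac12Q-\frac12Q^{\mathsf T}$, $\Sigma_{22}=\Pi A_d+A_d^{\mathsf T}\Pi^{\mathsf T}-\Theta$, $\Sigma_{41}=L-Q-\frac12Q^{\mathsf T}$, $$\Sigma=\begin{bmatrix}\Sigma_{11}&\Gamma A_d&\Gamma B_d&\Sigma_{41}^{\mathsf T}&0\\A_d^{\mathsf T}\Gamma^{\mathsf T}&\Sigma_{22}&\Pi B_d&A_d^{\mathsf T}\Gamma^{\mathsf T}&C_d^{\mathsf T}\\B_d^{\mathsf T}\Gamma^{\mathsf T}&B_d^{\mathsf T}\Pi^{\mathsf T}&-\gamma^2I_q&B_d^{\mathsf T}\Gamma^{\mathsf T}&D_d^{\mathsf T}\\\Sigma_{41}&\Gamma A_d&\Gamma B_d&-Q-Q^{\mathsf T}&0\\0&C_d&D_d&0&-I_p\end{bmatrix},$$ $$M_1=\begin{bmatrix}\Gamma M_A^d&\Gamma M_B^d&0&0\\\Pi M_A^d&\Pi M_B^d&0&0\\0&0&0&0\\\Gamma M_A^d&\Gamma M_B^d&0&0\\0&0&M_C&M_D\end{bmatrix},\qquad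 N_1=\begin{bmatrix}0&N_A^d&0&0&0\\0&0&N_B&0&0\\0&N_C^d&0&0&0\\0&0&N_D&0&0\end{bmatrix}.$$ Then for every $\Delta\in\mathbb R^{s\times s}$ with $\Delta^{\mathsf T}\Delta\le I_s$ the system is admissible and $\|P_\Delta\|_\infty<\gamma$. -/

import Mathlib

open scoped ENNReal NNReal Matrix

/-- The constant real data of the uncertain descriptor system
`E x(k+1) = A_Δ x(k) + B_{Δw} w(k)`, `y(k) = C_Δ x(k) + D_{Δw} w(k)`
(state in `ℝⁿ`, disturbance in `ℝ^q`, output in `ℝ^p`, uncertainty `Δ` of size `s × s`). -/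
structure UncertainDescriptorSystem (n q p s : ℕ) where
  E : Matrix (Fin n) (Fin n) ℝ
  A : Matrix (Fin n) (Fin n) ℝ
  Bw : Matrix (Fin n) (Fin q) ℝ
  C : Matrix (Fin p) (Fin n) ℝ
  Dw : Matrix (Fin p) (Fin q) ℝ
  MA : Matrix (Fin n) (Fin s) ℝ
  NA : Matrix (Fin s) (Fin n) ℝ
  MB : Matrix (Fin n) (Fin s) ℝ
  NB : Matrix (Fin s) (Fin q) ℝ
  MC : Matrix (Fin p) (Fin s) ℝ
  NC : Matrix (Fin s) (Fin n) ℝ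
  MD : Matrix (Fin p) (Fin s) ℝ
  ND : Matrix (Fin s) (Fin q) ℝ

namespace UncertainDescriptorSystem

variable {n q p s : ℕ} (sys : UncertainDescriptorSystem n q p s)

/-- `A_Δ = A + M_A Δ N_A`. -/
def AΔ (Δ : Matrix (Fin s) (Fin s) ℝ) : Matrix (Fin n) (Fin n) ℝ :=
  sys.A + sys.MA * Δ * sys.NA

/-- `B_{Δw} = B_w + M_B Δ N_B`. -/
def BΔ (Δ : Matrix (Fin s) (Fin s) ℝ) : Matrix (Fin n) (Fin q) ℝ :=
  sys.Bw + sys.MB * Δ * sys.NB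

/-- `C_Δ = C + M_C Δ N_C`. -/
def CΔ (Δ : Matrix (Fin s) (Fin s) ℝ) : Matrix (Fin p) (Fin n) ℝ :=
  sys.C + sys.MC * Δ * sys.NC

/-- `D_{Δw} = D_w + M_D Δ N_D`. -/
def DΔ (Δ : Matrix (Fin s) (Fin s) ℝ) : Matrix (Fin p) (Fin q) ℝ :=
  sys.Dw + sys.MD * Δ * sys.ND

end UncertainDescriptorSystem

namespace Descriptor

/-- The real matrix `M` read as a complex matrix. -/
noncomputable def toC {ι κ : Type*} (M : Matrix ι κ ℝ) : Matrix ι κ ℂ :=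
  M.map (fun x : ℝ => (x : ℂ))

section Pencil

variable {n : ℕ}

/-- The complex matrix `z E - A`. -/
noncomputable def pencil (E A : Matrix (Fin n) (Fin n) ℝ) (z : ℂ) :
    Matrix (Fin n) (Fin n) ℂ :=
  z • toC E - toC A

/-- The polynomial `det (λ E - A)` in the indeterminate `λ`. -/
noncomputable def charPoly (E A : Matrix (Fin n) (Fin n) ℝ) : Polynomial ℝ :=
  Matrix.det ((Polynomial.X : Polynomial ℝ) • E.map Polynomial.C - A.map Polynomial.C)

/-- Regularity: `det (λ E - A) ≠ 0` for some complex `λ`. -/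
def IsRegular (E A : Matrix (Fin n) (Fin n) ℝ) : Prop :=
  ∃ z : ℂ, (pencil E A z).det ≠ 0

/-- Causality: `deg det (λ E - A) = rank E`. -/
def IsCausal (E A : Matrix (Fin n) (Fin n) ℝ) : Prop :=
  (charPoly E A).degree = (E.rank : WithBot ℕ)

/-- The generalized spectral radius `ρ(E, A)`, the largest modulus of a complex zero of
`det (z E - A)` (it is `0` if there is no zero). -/
noncomputable def genSpectralRadius (E A : Matrix (Fin n) (Fin n) ℝ) : ℝ≥0∞ :=
  ⨆ z ∈ {z : ℂ | (pencil E A z).det = 0}, (‖z‖₊ : ℝ≥0∞)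

/-- Stability: `ρ(E, A) < 1`. -/
def IsStable (E A : Matrix (Fin n) (Fin n) ℝ) : Prop :=
  genSpectralRadius E A < 1

/-- Admissibility of `E x(k+1) = A x(k) + …`. -/
def IsAdmissible (E A : Matrix (Fin n) (Fin n) ℝ) : Prop :=
  IsRegular E A ∧ IsCausal E A ∧ IsStable E A

end Pencil

/-- The transfer function `P(z) = C (z E - A)⁻¹ B + D`. -/
noncomputable def transferFunction {n m p : ℕ} (E A : Matrix (Fin n) (Fin n) ℝ)
    (B : Matrix (Fin n) (Fin m) ℝ) (C : Matrix (Fin p) (Fin n) ℝ)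
    (D : Matrix (Fin p) (Fin m) ℝ) (z : ℂ) : Matrix (Fin p) (Fin m) ℂ :=
  toC C * (pencil E A z)⁻¹ * toC B + toC D

/-- The maximal singular value `σ̄(M) = √ρ(M* M)`. -/
noncomputable def maxSingularValue {m p : ℕ} (M : Matrix (Fin p) (Fin m) ℂ) : ℝ≥0∞ :=
  spectralRadius ℂ (Mᴴ * M) ^ (1 / 2 : ℝ)

/-- The `H_∞` norm (Hardy norm on the exterior of the closed unit disc) of a transfer function:
the supremum over `|z| > 1` of `σ̄(P(z))`. For an admissible system `P` has no pole in `|z| ≥ 1`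
and is bounded at infinity, so that this is also the supremum of `σ̄(P(e^{iω}))` over real `ω`. -/
noncomputable def hInfNorm {m p : ℕ} (P : ℂ → Matrix (Fin p) (Fin m) ℂ) : ℝ≥0∞ :=
  ⨆ z ∈ {z : ℂ | 1 < ‖z‖}, maxSingularValue (P z)

/-- Nonsingularity of a matrix whose rows and columns may be labelled differently:
it has a two-sided inverse. -/
def IsNonsingular {ι κ : Type*} [Fintype ι] [Fintype κ] [DecidableEq ι] [DecidableEq κ]
    (W : Matrix ι κ ℝ) : Prop :=
  ∃ W' : Matrix κ ι ℝ, W * W' = 1 ∧ W' * W = 1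

/-- `M < 0` for a real matrix: `M` is symmetric and negative definite. -/
def IsNegDef {ι : Type*} (M : Matrix ι ι ℝ) : Prop := (-M).PosDef

section Blocks

variable {ι a b c d e : Type*}

/-- The block row `[X₁ X₂ X₃ X₄]`. -/
def row4 (X₁ : Matrix ι a ℝ) (X₂ : Matrix ι b ℝ) (X₃ : Matrix ι c ℝ) (X₄ : Matrix ι d ℝ) :
    Matrix ι (a ⊕ b ⊕ c ⊕ d) ℝ :=
  Matrix.fromCols X₁ (Matrix.fromCols X₂ (Matrix.fromCols X₃ X₄))

/-- The block row `[X₁ X₂ X₃ X₄ X₅]`. -/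
def row5 (X₁ : Matrix ι a ℝ) (X₂ : Matrix ι b ℝ) (X₃ : Matrix ι c ℝ) (X₄ : Matrix ι d ℝ)
    (X₅ : Matrix ι e ℝ) : Matrix ι (a ⊕ b ⊕ c ⊕ d ⊕ e) ℝ :=
  Matrix.fromCols X₁ (row4 X₂ X₃ X₄ X₅)

/-- Four block rows on top of each other. -/
def stack4 (X₁ : Matrix a ι ℝ) (X₂ : Matrix b ι ℝ) (X₃ : Matrix c ι ℝ) (X₄ : Matrix d ι ℝ) :
    Matrix (a ⊕ b ⊕ c ⊕ d) ι ℝ :=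
  Matrix.fromRows X₁ (Matrix.fromRows X₂ (Matrix.fromRows X₃ X₄))

/-- Five block rows on top of each other. -/
def stack5 (X₁ : Matrix a ι ℝ) (X₂ : Matrix b ι ℝ) (X₃ : Matrix c ι ℝ) (X₄ : Matrix d ι ℝ)
    (X₅ : Matrix e ι ℝ) : Matrix (a ⊕ b ⊕ c ⊕ d ⊕ e) ι ℝ :=
  Matrix.fromRows X₁ (stack4 X₂ X₃ X₄ X₅)

end Blocks

section LMI

/-- Labels of the coordinates `(x₁, x₂) ∈ ℝ^r × ℝ^{n-r}` of the transformed state. -/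
abbrev St (r n : ℕ) : Type := Fin r ⊕ Fin (n - r)

variable {n q p s r : ℕ}

/-- `Γ = [Q R]`. -/
def GammaMat (Q : Matrix (Fin r) (Fin r) ℝ) (R : Matrix (Fin r) (Fin (n - r)) ℝ) :
    Matrix (Fin r) (St r n) ℝ :=
  Matrix.fromCols Q R

/-- `Π = [[0, 0], [0, S]]`. -/
def PiMat (S : Matrix (Fin (n - r)) (Fin (n - r)) ℝ) : Matrix (St r n) (St r n) ℝ :=
  Matrix.fromBlocks 0 0 0 S

/-- `Θ = [[L, 0], [0, 0]]`. -/
def ThetaMat (L : Matrix (Fin r) (Fin r) ℝ) : Matrix (St r n) (St r n) ℝ :=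
  Matrix.fromBlocks L 0 0 0

/-- The matrix `Σ`, for given matrices `A_d`, `B_{wd}`, `C_d`, `D_d`. -/
noncomputable def SigmaMat (γ : ℝ) (Ad : Matrix (St r n) (St r n) ℝ)
    (Bd : Matrix (St r n) (Fin q) ℝ) (Cd : Matrix (Fin p) (St r n) ℝ)
    (Dd : Matrix (Fin p) (Fin q) ℝ)
    (L Q : Matrix (Fin r) (Fin r) ℝ) (R : Matrix (Fin r) (Fin (n - r)) ℝ)
    (S : Matrix (Fin (n - r)) (Fin (n - r)) ℝ) :
    Matrix (Fin r ⊕ St r n ⊕ Fin q ⊕ Fin r ⊕ Fin p) (Fin r ⊕ St r n ⊕ Fin q ⊕ Fin r ⊕ Fin p) ℝ :=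
  let G : Matrix (Fin r) (St r n) ℝ := GammaMat Q R
  let P : Matrix (St r n) (St r n) ℝ := PiMat S
  let S11 : Matrix (Fin r) (Fin r) ℝ := -((1 / 2 : ℝ) • Q) - (1 / 2 : ℝ) • Qᵀ
  let S22 : Matrix (St r n) (St r n) ℝ := P * Ad + Adᵀ * Pᵀ - ThetaMat L
  let S41 : Matrix (Fin r) (Fin r) ℝ := L - Q - (1 / 2 : ℝ) • Qᵀ
  stack5
    (row5 S11         (G * Ad)    (G * Bd)             S41ᵀ        0)
    (row5 (Adᵀ * Gᵀ)  S22         (P * Bd)             (Adᵀ * Gᵀ)  Cdᵀ)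
    (row5 (Bdᵀ * Gᵀ)  (Bdᵀ * Pᵀ)  (-(γ ^ 2 • 1))       (Bdᵀ * Gᵀ)  Ddᵀ)
    (row5 S41         (G * Ad)    (G * Bd)             (-Q - Qᵀ)   0)
    (row5 0           Cd          Dd                   0           (-1))

/-- The matrix `M₁`, for given matrices `M_A^d`, `M_B^d`, `M_C^d`, `M_D`. -/
def M1Mat (MAd MBd : Matrix (St r n) (Fin s) ℝ) (MCd MDd : Matrix (Fin p) (Fin s) ℝ)
    (Q : Matrix (Fin r) (Fin r) ℝ) (R : Matrix (Fin r) (Fin (n - r)) ℝ)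
    (S : Matrix (Fin (n - r)) (Fin (n - r)) ℝ) :
    Matrix (Fin r ⊕ St r n ⊕ Fin q ⊕ Fin r ⊕ Fin p) (Fin s ⊕ Fin s ⊕ Fin s ⊕ Fin s) ℝ :=
  let G : Matrix (Fin r) (St r n) ℝ := GammaMat Q R
  let P : Matrix (St r n) (St r n) ℝ := PiMat S
  stack5
    (row4 (G * MAd) (G * MBd) 0   0)
    (row4 (P * MAd) (P * MBd) 0   0)
    (row4 0         0         0   0)
    (row4 (G * MAd) (G * MBd) 0   0)
    (row4 0         0         MCd MDd)

/-- The matrix `N₁`, for given matrices `N_A^d`, `N_B^d`, `N_C^d`, `N_D`. -/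
def N1Mat (NAd : Matrix (Fin s) (St r n) ℝ) (NBd : Matrix (Fin s) (Fin q) ℝ)
    (NCd : Matrix (Fin s) (St r n) ℝ) (NDd : Matrix (Fin s) (Fin q) ℝ) :
    Matrix (Fin s ⊕ Fin s ⊕ Fin s ⊕ Fin s) (Fin r ⊕ St r n ⊕ Fin q ⊕ Fin r ⊕ Fin p) ℝ :=
  stack4
    (row5 0 NAd 0   0 0)
    (row5 0 0   NBd 0 0)
    (row5 0 NCd 0   0 0)
    (row5 0 0   NDd 0 0)

/-- The block matrix `[[Σ + ε N₁ᵀ N₁, M₁], [M₁ᵀ, -ε I]]` of the system `sys`, transformed by the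
matrices `W` and `V` (`A_d = W A V`, `B_{wd} = W B_w`, `C_d = C V`, `D_d = D_w`,
`M_A^d = W M_A`, `N_A^d = N_A V`, `M_B^d = W M_B`, `N_B^d = N_B`, `M_C^d = M_C`,
`N_C^d = N_C V`). -/
noncomputable def lmiMat (sys : UncertainDescriptorSystem n q p s)
    (W : Matrix (St r n) (Fin n) ℝ) (V : Matrix (Fin n) (St r n) ℝ) (γ ε : ℝ)
    (L Q : Matrix (Fin r) (Fin r) ℝ) (R : Matrix (Fin r) (Fin (n - r)) ℝ)
    (S : Matrix (Fin (n - r)) (Fin (n - r)) ℝ) :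
    Matrix ((Fin r ⊕ St r n ⊕ Fin q ⊕ Fin r ⊕ Fin p) ⊕ (Fin s ⊕ Fin s ⊕ Fin s ⊕ Fin s))
      ((Fin r ⊕ St r n ⊕ Fin q ⊕ Fin r ⊕ Fin p) ⊕ (Fin s ⊕ Fin s ⊕ Fin s ⊕ Fin s)) ℝ :=
  let Sg : Matrix (Fin r ⊕ St r n ⊕ Fin q ⊕ Fin r ⊕ Fin p)
      (Fin r ⊕ St r n ⊕ Fin q ⊕ Fin r ⊕ Fin p) ℝ :=
    SigmaMat γ (W * sys.A * V) (W * sys.Bw) (sys.C * V) sys.Dw L Q R S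
  let M1 : Matrix (Fin r ⊕ St r n ⊕ Fin q ⊕ Fin r ⊕ Fin p)
      (Fin s ⊕ Fin s ⊕ Fin s ⊕ Fin s) ℝ :=
    M1Mat (W * sys.MA) (W * sys.MB) sys.MC sys.MD Q R S
  let N1 : Matrix (Fin s ⊕ Fin s ⊕ Fin s ⊕ Fin s)
      (Fin r ⊕ St r n ⊕ Fin q ⊕ Fin r ⊕ Fin p) ℝ :=
    N1Mat (sys.NA * V) sys.NB (sys.NC * V) sys.ND
  Matrix.fromBlocks (Sg + ε • (N1ᵀ * N1)) M1 M1ᵀ (-(ε • 1))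

end LMI

end Descriptor

/-! ### The matrix inequality as a quadratic form -/

namespace Descriptor

/-! In the coordinates given by `W` and `V`, write `A_Δ x + B_Δ w = (u, 0)` and let `y` be the
output. The matrix inequality is evaluated at one vector, built from `u`, `x`, `w`, `u/2`, `y` and
the uncertainty signals `Δ N x`, `Δ N w`. There all terms in `Q`, `R`, `S` cancel, the `ε` terms
have a favourable sign because `ΔᵀΔ ≤ I`, and what remains is strict dissipation with storage `x₁ᵀ L
x₁`: `uᵀLu + |y|² + d(|x|² + |w|²) ≤ x₁ᵀLx₁ + γ²|w|²`, with `d > 0` (`dissipation`).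

Everything else follows from this inequality. If `u = z x₁` with `|z| ≥ 1`, the storage terms can be
dropped (`complex_dissipation`). Taking `w = 0` excludes zeros of the pencil in `|z| ≥ 1`, which
gives regularity and stability. Taking `x₁ = 0`, `w = 0` shows that the block `A₂₂` is nonsingular
(`toBlocks₂₂_det_ne_zero`), and a Schur complement turns this into causality (`degree_charPoly`).
Taking `x = (zE - A_Δ)⁻¹ B_Δ w` gives `|P(z)w|² ≤ (γ² - d)|w|²`; since `d` does not depend on `z`,
the supremum stays strictly below `γ`. -/

lemma dotProduct_transpose_mulVec {ι κ : Type*} [Fintype ι] [Fintype κ]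
    (M : Matrix κ ι ℝ) (u : ι → ℝ) (v : κ → ℝ) : u ⬝ᵥ Mᵀ *ᵥ v = v ⬝ᵥ M *ᵥ u := by
  rw [Matrix.mulVec_transpose, dotProduct_comm, ← Matrix.dotProduct_mulVec]

lemma transpose_mulVec_dotProduct {ι κ : Type*} [Fintype ι] [Fintype κ]
    (M : Matrix κ ι ℝ) (u : ι → ℝ) (v : κ → ℝ) : Mᵀ *ᵥ v ⬝ᵥ u = v ⬝ᵥ M *ᵥ u := by
  rw [dotProduct_comm, dotProduct_transpose_mulVec]

section LMI

variable {n q p s r : ℕ}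

/-- The quadratic form of the block matrix `lmiMat`, expanded. -/
lemma lmiMat_quadraticForm (sys : UncertainDescriptorSystem n q p s)
    (W : Matrix (St r n) (Fin n) ℝ) (V : Matrix (Fin n) (St r n) ℝ) (γ ε : ℝ)
    (L Q : Matrix (Fin r) (Fin r) ℝ) (R : Matrix (Fin r) (Fin (n - r)) ℝ)
    (S : Matrix (Fin (n - r)) (Fin (n - r)) ℝ)
    (a b : Fin r → ℝ) (x : St r n → ℝ) (w : Fin q → ℝ) (y : Fin p → ℝ)
    (e₁ e₂ e₃ e₄ : Fin s → ℝ) :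
    let ξ := Sum.elim (Sum.elim a (Sum.elim x (Sum.elim w (Sum.elim b y))))
      (Sum.elim e₁ (Sum.elim e₂ (Sum.elim e₃ e₄)))
    let f := (W * sys.A * V) *ᵥ x + (W * sys.Bw) *ᵥ w + (W * sys.MA) *ᵥ e₁ + (W * sys.MB) *ᵥ e₂
    let g := (sys.C * V) *ᵥ x + sys.Dw *ᵥ w + sys.MC *ᵥ e₃ + sys.MD *ᵥ e₄
    let na := (sys.NA * V) *ᵥ x
    let nb := sys.NB *ᵥ w
    let nc := (sys.NC * V) *ᵥ x
    let nd := sys.ND *ᵥ w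
    ξ ⬝ᵥ lmiMat sys W V γ ε L Q R S *ᵥ ξ =
      -(a ⬝ᵥ Q *ᵥ a) + 2 * ((a + b) ⬝ᵥ GammaMat Q R *ᵥ f) + 2 * (b ⬝ᵥ L *ᵥ a)
        - 2 * (b ⬝ᵥ Q *ᵥ a) - a ⬝ᵥ Q *ᵥ b - 2 * (b ⬝ᵥ Q *ᵥ b)
        + 2 * (x ⬝ᵥ PiMat S *ᵥ f) - x ⬝ᵥ ThetaMat L *ᵥ x - γ ^ 2 * (w ⬝ᵥ w)
        + 2 * (y ⬝ᵥ g) - y ⬝ᵥ y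
        + ε * ((na ⬝ᵥ na - e₁ ⬝ᵥ e₁) + (nb ⬝ᵥ nb - e₂ ⬝ᵥ e₂) + (nc ⬝ᵥ nc - e₃ ⬝ᵥ e₃)
          + (nd ⬝ᵥ nd - e₄ ⬝ᵥ e₄)) := by
  intro ξ f g na nb nc nd
  simp only [ξ, f, g, na, nb, nc, nd, lmiMat]
  generalize W * sys.A * V = A, W * sys.Bw = B, W * sys.MA = MA, W * sys.MB = MB,
    sys.C * V = C, sys.NA * V = NA, sys.NC * V = NC
  simp only [SigmaMat, M1Mat, N1Mat, row4, row5, stack4, stack5, Matrix.fromBlocks_mulVec,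
    Matrix.fromRows_mulVec, Matrix.fromCols_mulVec_sumElim, sumElim_dotProduct_sumElim,
    Matrix.add_mulVec, Matrix.sub_mulVec, Matrix.neg_mulVec, Matrix.smul_mulVec,
    Matrix.one_mulVec, Matrix.zero_mulVec, Matrix.mulVec_add, dotProduct_add, add_dotProduct,
    dotProduct_sub, dotProduct_neg, dotProduct_smul, smul_eq_mul, ← Matrix.mulVec_mulVec,
    Sum.elim_comp_inl, Sum.elim_comp_inr, dotProduct_transpose_mulVec,
    transpose_mulVec_dotProduct, Matrix.transpose_transpose, Matrix.transpose_sub,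
    Matrix.transpose_smul, dotProduct_zero, add_zero, zero_add]
  ring

end LMI
end Descriptor

/-! ### From the matrix inequality to strict dissipation -/

namespace Descriptor

/-- The Rayleigh quotient is homogeneous of degree zero, so its minimum over any compact sphere
works; here the sphere is that of the sup norm. It is empty only when `ι` is. -/
lemma exists_pos_mul_dotProduct_le {ι : Type*} [Fintype ι] {M : Matrix ι ι ℝ} (hM : M.PosDef) :
    ∃ d : ℝ, 0 < d ∧ ∀ x : ι → ℝ, d * (x ⬝ᵥ x) ≤ x ⬝ᵥ M *ᵥ x := by
  have pos : ∀ x : ι → ℝ, x ≠ 0 → 0 < x ⬝ᵥ M *ᵥ x := fun x hx => by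
    simpa using hM.dotProduct_mulVec_pos hx
  have pos' : ∀ x : ι → ℝ, x ≠ 0 → 0 < x ⬝ᵥ x := fun x hx => by
    simpa using Matrix.dotProduct_star_self_pos_iff.2 hx
  have ne : ∀ x ∈ Metric.sphere (0 : ι → ℝ) 1, x ≠ 0 := fun x hx =>
    ne_zero_of_mem_unit_sphere (⟨x, hx⟩ : Metric.sphere (0 : ι → ℝ) 1)
  have mem : ∀ x : ι → ℝ, x ≠ 0 → ‖x‖⁻¹ • x ∈ Metric.sphere (0 : ι → ℝ) 1 := fun x hx => by
    simp [norm_smul, hx]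
  rcases (Metric.sphere (0 : ι → ℝ) 1).eq_empty_or_nonempty with h | h
  · refine ⟨1, one_pos, fun x => ?_⟩
    by_cases hx : x = 0
    · simp [hx]
    · have := mem x hx
      simp [h] at this
  · have hc : ContinuousOn (fun x : ι → ℝ => (x ⬝ᵥ M *ᵥ x) / (x ⬝ᵥ x))
        (Metric.sphere (0 : ι → ℝ) 1) :=
      ContinuousOn.div (by fun_prop) (by fun_prop) fun x hx => (pos' x (ne x hx)).ne'
    obtain ⟨x₀, hx₀, hmin⟩ := (isCompact_sphere (0 : ι → ℝ) 1).exists_isMinOn h hc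
    refine ⟨_, div_pos (pos x₀ (ne x₀ hx₀)) (pos' x₀ (ne x₀ hx₀)), fun x => ?_⟩
    by_cases hx : x = 0
    · simp [hx]
    have h1 := hmin (mem x hx)
    simp only [Set.mem_ofPred_eq, Matrix.mulVec_smul, smul_dotProduct, dotProduct_smul,
      smul_eq_mul] at h1
    have hn : ‖x‖⁻¹ ≠ 0 := inv_ne_zero (norm_ne_zero_iff.2 hx)
    rwa [mul_div_mul_left _ _ hn, mul_div_mul_left _ _ hn, le_div_iff₀ (pos' x hx)] at h1

lemma mulVec_dotProduct_self_le {ι κ : Type*} [Fintype ι] [Fintype κ] [DecidableEq ι]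
    {D : Matrix κ ι ℝ} (hD : (1 - Dᵀ * D).PosSemidef) (v : ι → ℝ) :
    D *ᵥ v ⬝ᵥ D *ᵥ v ≤ v ⬝ᵥ v := by
  have h := hD.dotProduct_mulVec_nonneg v
  simp only [star_trivial, Matrix.sub_mulVec, Matrix.one_mulVec, ← Matrix.mulVec_mulVec,
    dotProduct_sub, dotProduct_transpose_mulVec] at h
  linarith

section LMI

variable {n q p s r : ℕ}

/-- The dissipation inequality, for real trajectories, that the matrix inequality entails. -/
lemma dissipation {sys : UncertainDescriptorSystem n q p s}
    {W : Matrix (St r n) (Fin n) ℝ} {V : Matrix (Fin n) (St r n) ℝ} {γ ε : ℝ} (hε : 0 < ε)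
    {L Q : Matrix (Fin r) (Fin r) ℝ} {R : Matrix (Fin r) (Fin (n - r)) ℝ}
    {S : Matrix (Fin (n - r)) (Fin (n - r)) ℝ}
    (hneg : IsNegDef (lmiMat sys W V γ ε L Q R S)) :
    ∃ d : ℝ, 0 < d ∧ ∀ Δ : Matrix (Fin s) (Fin s) ℝ, (1 - Δᵀ * Δ).PosSemidef →
      ∀ (x : St r n → ℝ) (w : Fin q → ℝ) (u : Fin r → ℝ),
        (W * sys.AΔ Δ * V) *ᵥ x + (W * sys.BΔ Δ) *ᵥ w = Sum.elim u 0 →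
        ∀ y : Fin p → ℝ, y = (sys.CΔ Δ * V) *ᵥ x + sys.DΔ Δ *ᵥ w →
        u ⬝ᵥ L *ᵥ u + y ⬝ᵥ y + d * (x ⬝ᵥ x + w ⬝ᵥ w) ≤
          (x ∘ Sum.inl) ⬝ᵥ L *ᵥ (x ∘ Sum.inl) + γ ^ 2 * (w ⬝ᵥ w) := by
  obtain ⟨d, hd, hM⟩ := exists_pos_mul_dotProduct_le hneg
  refine ⟨d, hd, fun Δ hΔ x w u hu y hy => ?_⟩
  -- The factor `1/2` is chosen so that the multiples of `uᵀQu` add up to `-1 + 3 - 1 - 1/2 - 1/2 =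
  -- 0`, while `2 bᵀLa` becomes exactly `uᵀLu`.
  have h := hM (Sum.elim (Sum.elim u (Sum.elim x (Sum.elim w (Sum.elim ((1 / 2 : ℝ) • u) y))))
      (Sum.elim (Δ *ᵥ ((sys.NA * V) *ᵥ x)) (Sum.elim (Δ *ᵥ (sys.NB *ᵥ w))
        (Sum.elim (Δ *ᵥ ((sys.NC * V) *ᵥ x)) (Δ *ᵥ (sys.ND *ᵥ w))))))
  rw [Matrix.neg_mulVec, dotProduct_neg, lmiMat_quadraticForm] at h
  have ef : (W * sys.A * V) *ᵥ x + (W * sys.Bw) *ᵥ w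
      + (W * sys.MA) *ᵥ (Δ *ᵥ ((sys.NA * V) *ᵥ x)) + (W * sys.MB) *ᵥ (Δ *ᵥ (sys.NB *ᵥ w))
      = Sum.elim u 0 := by
    rw [← hu, UncertainDescriptorSystem.AΔ, UncertainDescriptorSystem.BΔ]
    simp only [Matrix.mul_add, Matrix.add_mul, Matrix.add_mulVec, Matrix.mulVec_mulVec,
      Matrix.mul_assoc]
    abel
  have eg : (sys.C * V) *ᵥ x + sys.Dw *ᵥ w + sys.MC *ᵥ (Δ *ᵥ ((sys.NC * V) *ᵥ x))
      + sys.MD *ᵥ (Δ *ᵥ (sys.ND *ᵥ w)) = y := by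
    rw [hy, UncertainDescriptorSystem.CΔ, UncertainDescriptorSystem.DΔ]
    simp only [Matrix.add_mul, Matrix.add_mulVec, Matrix.mulVec_mulVec, Matrix.mul_assoc]
    abel
  have eGamma : GammaMat Q R *ᵥ Sum.elim u 0 = Q *ᵥ u := by simp [GammaMat]
  have ePi : PiMat (r := r) S *ᵥ Sum.elim u 0 = 0 := by
    simp [PiMat, Matrix.fromBlocks_mulVec]
  have eTheta : x ⬝ᵥ ThetaMat (n := n) L *ᵥ x = (x ∘ Sum.inl) ⬝ᵥ L *ᵥ (x ∘ Sum.inl) := by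
    obtain ⟨x₁, x₂, rfl⟩ : ∃ x₁ x₂, x = Sum.elim x₁ x₂ := ⟨_, _, (Sum.elim_comp_inl_inr x).symm⟩
    simp [ThetaMat, Matrix.fromBlocks_mulVec]
  rw [ef, eg, eGamma, ePi, eTheta] at h
  simp only [sumElim_dotProduct_sumElim, add_dotProduct, Matrix.mulVec_smul, smul_dotProduct,
    dotProduct_smul, smul_eq_mul, dotProduct_zero] at h
  have nn : ∀ {ι : Type} [Fintype ι] (v : ι → ℝ), 0 ≤ v ⬝ᵥ v := fun v => by
    simpa using dotProduct_star_self_nonneg v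
  have c₁ := mulVec_dotProduct_self_le hΔ ((sys.NA * V) *ᵥ x)
  have c₂ := mulVec_dotProduct_self_le hΔ (sys.NB *ᵥ w)
  have c₃ := mulVec_dotProduct_self_le hΔ ((sys.NC * V) *ᵥ x)
  have c₄ := mulVec_dotProduct_self_le hΔ (sys.ND *ᵥ w)
  -- The S-procedure: the contraction property of `Δ` makes every `ε` term nonnegative.
  have hN := mul_nonneg hε.le (add_nonneg (add_nonneg (add_nonneg (sub_nonneg.2 c₁)
    (sub_nonneg.2 c₂)) (sub_nonneg.2 c₃)) (sub_nonneg.2 c₄))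
  -- Of `d` times the squared length of the test vector, only the `x` and `w` parts are kept.
  have hR := mul_nonneg hd.le (add_nonneg (add_nonneg (nn u) (nn y))
    (add_nonneg (add_nonneg (add_nonneg (nn (Δ *ᵥ ((sys.NA * V) *ᵥ x)))
    (nn (Δ *ᵥ (sys.NB *ᵥ w)))) (nn (Δ *ᵥ ((sys.NC * V) *ᵥ x)))) (nn (Δ *ᵥ (sys.ND *ᵥ w)))))
  have hu' := mul_nonneg hd.le (nn u)
  linarith

end LMI
end Descriptor

/-! ### Complex trajectories -/

namespace Descriptor

section Complexification

variable {ι κ μ : Type*}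

lemma toC_mul [Fintype ι] (M : Matrix μ ι ℝ) (N : Matrix ι κ ℝ) : toC (M * N) = toC M * toC N :=
  Matrix.map_mul (f := Complex.ofRealHom)

lemma toC_one [DecidableEq ι] : toC (1 : Matrix ι ι ℝ) = 1 := by
  simp [toC]

variable [Fintype ι]

lemma re_toC_mulVec (M : Matrix μ ι ℝ) (x : ι → ℂ) (i : μ) :
    ((toC M *ᵥ x) i).re = (M *ᵥ fun j => (x j).re) i := by
  simp [toC, Matrix.mulVec, dotProduct]

lemma im_toC_mulVec (M : Matrix μ ι ℝ) (x : ι → ℂ) (i : μ) :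
    ((toC M *ᵥ x) i).im = (M *ᵥ fun j => (x j).im) i := by
  simp [toC, Matrix.mulVec, dotProduct]

lemma sum_norm_sq (x : ι → ℂ) :
    ∑ i, ‖x i‖ ^ 2 = (fun i => (x i).re) ⬝ᵥ (fun i => (x i).re)
      + (fun i => (x i).im) ⬝ᵥ (fun i => (x i).im) := by
  simp only [dotProduct, ← Finset.sum_add_distrib, Complex.sq_norm, Complex.normSq_apply]

lemma sum_norm_sq_pos {x : ι → ℂ} (hx : x ≠ 0) : 0 < ∑ i, ‖x i‖ ^ 2 := by
  obtain ⟨i, hi⟩ := Function.ne_iff.1 hx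
  exact Finset.sum_pos' (fun _ _ => by positivity)
    ⟨i, Finset.mem_univ i, pow_pos (norm_pos_iff.2 hi) 2⟩

end Complexification

section Trajectories

variable {r q p : ℕ} {m : Type*} [Fintype m]

/-- A dissipation inequality for real trajectories passes to the complex trajectories
`z ^ k • x` with `1 ≤ |z|`. -/
lemma complex_dissipation {L : Matrix (Fin r) (Fin r) ℝ} (hL : L.PosDef)
    {A : Matrix (Fin r ⊕ m) (Fin r ⊕ m) ℝ} {B : Matrix (Fin r ⊕ m) (Fin q) ℝ}
    {C : Matrix (Fin p) (Fin r ⊕ m) ℝ} {D : Matrix (Fin p) (Fin q) ℝ} {γ d : ℝ}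
    (h : ∀ (x : Fin r ⊕ m → ℝ) (w : Fin q → ℝ) (u : Fin r → ℝ),
      A *ᵥ x + B *ᵥ w = Sum.elim u 0 → ∀ y : Fin p → ℝ, y = C *ᵥ x + D *ᵥ w →
        u ⬝ᵥ L *ᵥ u + y ⬝ᵥ y + d * (x ⬝ᵥ x + w ⬝ᵥ w) ≤
          (x ∘ Sum.inl) ⬝ᵥ L *ᵥ (x ∘ Sum.inl) + γ ^ 2 * (w ⬝ᵥ w))
    {z : ℂ} (hz : 1 ≤ ‖z‖) (x : Fin r ⊕ m → ℂ) (w : Fin q → ℂ)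
    (hx : toC A *ᵥ x + toC B *ᵥ w = z • Sum.elim (x ∘ Sum.inl) 0) :
    ∑ i, ‖(toC C *ᵥ x + toC D *ᵥ w) i‖ ^ 2 + d * (∑ i, ‖x i‖ ^ 2 + ∑ i, ‖w i‖ ^ 2) ≤
      γ ^ 2 * ∑ i, ‖w i‖ ^ 2 := by
  set a : Fin r → ℝ := fun i => (x (Sum.inl i)).re
  set b : Fin r → ℝ := fun i => (x (Sum.inl i)).im
  have h1 := h (fun i => (x i).re) (fun i => (w i).re) (z.re • a - z.im • b) (by
    ext i
    have := congrArg Complex.re (congrFun hx i)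
    rw [Pi.add_apply, Complex.add_re, re_toC_mulVec, re_toC_mulVec] at this
    rw [Pi.add_apply, this]
    rcases i with i | i <;> simp [a, b]) _ rfl
  have h2 := h (fun i => (x i).im) (fun i => (w i).im) (z.re • b + z.im • a) (by
    ext i
    have := congrArg Complex.im (congrFun hx i)
    rw [Pi.add_apply, Complex.add_im, im_toC_mulVec, im_toC_mulVec] at this
    rw [Pi.add_apply, this]
    rcases i with i | i <;> simp [a, b]) _ rfl
  have nn : ∀ v : Fin r → ℝ, 0 ≤ v ⬝ᵥ L *ᵥ v := fun v => by
    simpa using hL.posSemidef.dotProduct_mulVec_nonneg v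
  have hz2 : 1 ≤ z.re * z.re + z.im * z.im := by
    rw [← Complex.normSq_apply, ← Complex.sq_norm]
    exact one_le_pow₀ hz
  -- Adding the real and imaginary parts cancels the cross terms, so multiplication by `z` scales
  -- the storage by `|z|² ≥ 1`.
  have key : (z.re • a - z.im • b) ⬝ᵥ L *ᵥ (z.re • a - z.im • b)
      + (z.re • b + z.im • a) ⬝ᵥ L *ᵥ (z.re • b + z.im • a)
      = (z.re * z.re + z.im * z.im) * (a ⬝ᵥ L *ᵥ a + b ⬝ᵥ L *ᵥ b) := by
    simp only [Matrix.mulVec_add, Matrix.mulVec_sub, Matrix.mulVec_smul, add_dotProduct,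
      sub_dotProduct, dotProduct_add, dotProduct_sub, smul_dotProduct, dotProduct_smul,
      smul_eq_mul]
    ring
  have key2 := mul_le_mul_of_nonneg_right hz2 (add_nonneg (nn a) (nn b))
  have e1 : (fun i => (x i).re) ∘ Sum.inl = a := rfl
  have e2 : (fun i => (x i).im) ∘ Sum.inl = b := rfl
  have e3 : (fun i => ((toC C *ᵥ x + toC D *ᵥ w) i).re)
      = C *ᵥ (fun i => (x i).re) + D *ᵥ fun i => (w i).re := by
    ext i
    simp [re_toC_mulVec]
  have e4 : (fun i => ((toC C *ᵥ x + toC D *ᵥ w) i).im)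
      = C *ᵥ (fun i => (x i).im) + D *ᵥ fun i => (w i).im := by
    ext i
    simp [im_toC_mulVec]
  rw [sum_norm_sq, sum_norm_sq, sum_norm_sq, e3, e4]
  rw [e1] at h1
  rw [e2] at h2
  linarith

end Trajectories

/-! ### Zeros and degree of the pencil determinant -/

section Pencil

variable {n r : ℕ} {E A : Matrix (Fin n) (Fin n) ℝ}

lemma det_pencil_eq_aeval (E A : Matrix (Fin n) (Fin n) ℝ) (z : ℂ) :
    (pencil E A z).det = Polynomial.aeval z (charPoly E A) := by
  rw [charPoly, AlgHom.map_det]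
  congr 1
  ext i j
  simp [pencil, toC]
  ring

/-- Finiteness of the zero set is what keeps the supremum strictly below `1`. -/
lemma isStable_of_norm_lt_one (hne : charPoly E A ≠ 0)
    (h : ∀ z : ℂ, (pencil E A z).det = 0 → ‖z‖ < 1) : IsStable E A := by
  have hfin : {z : ℂ | (pencil E A z).det = 0}.Finite := by
    refine ((charPoly E A).rootSet_finite ℂ).subset fun z hz => ?_
    rw [Polynomial.mem_rootSet]
    exact ⟨hne, by rw [← det_pencil_eq_aeval]; exact hz⟩
  have e : genSpectralRadius E A = hfin.toFinset.sup fun z => (‖z‖₊ : ℝ≥0∞) := by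
    simp [genSpectralRadius, Finset.sup_eq_iSup]
  rw [IsStable, e, Finset.sup_lt_iff (by simp)]
  intro z hz
  have := h z (by simpa using hz)
  exact_mod_cast this

lemma map_C_mul {ι κ μ : Type*} [Fintype ι] (M : Matrix μ ι ℝ) (N : Matrix ι κ ℝ) :
    (M * N).map Polynomial.C = M.map Polynomial.C * N.map Polynomial.C :=
  Matrix.map_mul (f := (Polynomial.C : ℝ →+* Polynomial ℝ))

/-- Up to nonzero constants, `det (λE - A)` is the determinant of the block matrix `[[λI - A₁₁,
-A₁₂], [-A₂₁, -A₂₂]]`. Eliminating the invertible constant block `-A₂₂` leaves the characteristic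
polynomial of `A₁₁ - A₁₂ A₂₂⁻¹ A₂₁`, of degree `r`. -/
lemma degree_charPoly {m : Type*} [Fintype m] [DecidableEq m]
    {W : Matrix (Fin r ⊕ m) (Fin n) ℝ} {V : Matrix (Fin n) (Fin r ⊕ m) ℝ}
    (hW : IsNonsingular W) (hV : IsNonsingular V)
    (hWEV : W * E * V = Matrix.fromBlocks 1 0 0 0)
    (h : (W * A * V).toBlocks₂₂.det ≠ 0) : (charPoly E A).degree = r := by
  obtain ⟨W', hW1, hW2⟩ := hW
  obtain ⟨V', hV1, hV2⟩ := hV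
  -- Rows and columns of `W` and `V` carry different labels, so they have no determinants of their
  -- own; the product `V * W` does.
  have hdet : (V * W).det ≠ 0 := by
    have : (V * W) * (W' * V') = 1 := by
      rw [Matrix.mul_assoc, ← Matrix.mul_assoc W, hW1, Matrix.one_mul, hV1]
    have h2 := congrArg Matrix.det this
    rw [Matrix.det_mul, Matrix.det_one] at h2
    exact left_ne_zero_of_mul_eq_one h2
  set P : Matrix (Fin n) (Fin n) (Polynomial ℝ) :=
    (Polynomial.X : Polynomial ℝ) • E.map Polynomial.C - A.map Polynomial.C with hP
  have e1 : (W.map Polynomial.C * P * V.map Polynomial.C).det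
      = charPoly E A * Polynomial.C (V * W).det := by
    have hWW : W.map Polynomial.C * W'.map Polynomial.C = 1 := by
      rw [← map_C_mul, hW1]; simp
    have hWW' : W'.map Polynomial.C * W.map Polynomial.C = 1 := by
      rw [← map_C_mul, hW2]; simp
    have : W.map Polynomial.C * P * V.map Polynomial.C =
        W.map Polynomial.C * (P * (V * W).map Polynomial.C) * W'.map Polynomial.C := by
      rw [map_C_mul]
      simp only [Matrix.mul_assoc, hWW, Matrix.mul_one]
    rw [this, Matrix.det_conj_of_mul_eq_one hWW hWW', Matrix.det_mul, RingHom.map_det]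
    rfl
  set F := W * A * V with hF
  set A₁₁ := F.toBlocks₁₁
  set A₁₂ := F.toBlocks₁₂
  set A₂₁ := F.toBlocks₂₁
  set A₂₂ := F.toBlocks₂₂
  have hFb : F = Matrix.fromBlocks A₁₁ A₁₂ A₂₁ A₂₂ := (Matrix.fromBlocks_toBlocks F).symm
  have hu : IsUnit A₂₂.det := h.isUnit
  have hinv : A₂₂ * A₂₂⁻¹ = 1 := Matrix.mul_nonsing_inv _ hu
  have hinv' : A₂₂⁻¹ * A₂₂ = 1 := Matrix.nonsing_inv_mul _ hu
  let _ : Invertible (-(A₂₂.map Polynomial.C)) :=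
    ⟨-(A₂₂⁻¹.map Polynomial.C), by rw [neg_mul_neg, ← map_C_mul, hinv']; simp,
      by rw [neg_mul_neg, ← map_C_mul, hinv]; simp⟩
  have e2 : W.map Polynomial.C * P * V.map Polynomial.C =
      Matrix.fromBlocks ((Polynomial.X : Polynomial ℝ) • 1 - A₁₁.map Polynomial.C)
        (-(A₁₂.map Polynomial.C)) (-(A₂₁.map Polynomial.C)) (-(A₂₂.map Polynomial.C)) := by
    rw [hP, Matrix.mul_sub, Matrix.sub_mul, Matrix.mul_smul, Matrix.smul_mul, ← map_C_mul,
      ← map_C_mul, ← map_C_mul, ← map_C_mul, hWEV, ← hF, hFb, Matrix.fromBlocks_map,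
      Matrix.fromBlocks_map, Matrix.fromBlocks_smul, sub_eq_add_neg,
      Matrix.fromBlocks_neg, Matrix.fromBlocks_add]
    simp [sub_eq_add_neg]
  have e3 : (Polynomial.X : Polynomial ℝ) • (1 : Matrix (Fin r) (Fin r) (Polynomial ℝ))
      - A₁₁.map Polynomial.C
      - -(A₁₂.map Polynomial.C) * ⅟(-(A₂₂.map Polynomial.C)) * -(A₂₁.map Polynomial.C)
      = (A₁₁ - A₁₂ * A₂₂⁻¹ * A₂₁).charmatrix := by
    change _ - _ - -(A₁₂.map Polynomial.C) * -(A₂₂⁻¹.map Polynomial.C) *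
      -(A₂₁.map Polynomial.C) = _
    simp only [Matrix.mul_neg, Matrix.neg_mul, neg_neg]
    rw [← map_C_mul, ← map_C_mul,
      Matrix.charmatrix,
      Matrix.scalar_apply, ← Matrix.smul_one_eq_diagonal]
    generalize A₁₂ * A₂₂⁻¹ * A₂₁ = K
    ext i j : 2
    simp
    ring
  rw [e2, Matrix.det_fromBlocks₂₂, e3] at e1
  have e4 : (-(A₂₂.map Polynomial.C)).det = Polynomial.C (-A₂₂).det := by
    rw [RingHom.map_det]
    congr 1
    ext i j
    simp
  have hdeg := congrArg Polynomial.degree e1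
  have h22 : (-A₂₂).det ≠ 0 := by
    rw [Matrix.det_neg]
    exact mul_ne_zero (pow_ne_zero _ (by norm_num)) h
  rw [e4, Polynomial.degree_mul, Polynomial.degree_mul, Polynomial.degree_C h22,
    Polynomial.degree_C hdet, zero_add, add_zero] at hdeg
  rw [← hdeg]
  exact (Matrix.charpoly_degree_eq_dim _).trans (by simp)

end Pencil

/-! ### Singular values from gain bounds -/

/-- An eigenvector `v` of `M* M` with eigenvalue `k` satisfies `k|v|² = |Mv|²`, so the gain bound
controls every eigenvalue. -/
lemma maxSingularValue_le {m p : ℕ} {M : Matrix (Fin p) (Fin m) ℂ} {c : ℝ} (hc : 0 ≤ c)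
    (h : ∀ v : Fin m → ℂ, ∑ i, ‖(M *ᵥ v) i‖ ^ 2 ≤ c * ∑ i, ‖v i‖ ^ 2) :
    maxSingularValue M ≤ ENNReal.ofReal (Real.sqrt c) := by
  have hr : spectralRadius ℂ (Mᴴ * M) ≤ ENNReal.ofReal c := by
    refine iSup₂_le fun k hk => ?_
    rw [← Matrix.spectrum_toLin', ← Module.End.hasEigenvalue_iff_mem_spectrum] at hk
    obtain ⟨v, hv⟩ := hk.exists_hasEigenvector
    have hv1 : (Mᴴ * M) *ᵥ v = k • v := by simpa using hv.apply_eq_smul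
    have nsq : ∀ {l : ℕ} (x : Fin l → ℂ), star x ⬝ᵥ x = ((∑ i, ‖x i‖ ^ 2 : ℝ) : ℂ) := by
      intro l x
      simp [dotProduct, Complex.conj_mul']
    have h1 : k * ((∑ i, ‖v i‖ ^ 2 : ℝ) : ℂ) = ((∑ i, ‖(M *ᵥ v) i‖ ^ 2 : ℝ) : ℂ) := by
      rw [← nsq, ← nsq, Matrix.star_mulVec, ← Matrix.dotProduct_mulVec, Matrix.mulVec_mulVec,
        hv1, dotProduct_smul, smul_eq_mul]
    have hpos := sum_norm_sq_pos hv.2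
    have h2 := congrArg norm h1
    rw [norm_mul, Complex.norm_of_nonneg hpos.le,
      Complex.norm_of_nonneg (Finset.sum_nonneg fun _ _ => by positivity)] at h2
    have h3 : ‖k‖ ≤ c := le_of_mul_le_mul_right (h2.trans_le (h v)) hpos
    change ‖k‖ₑ ≤ _
    rw [← ofReal_norm]
    exact ENNReal.ofReal_le_ofReal h3
  refine (ENNReal.rpow_le_rpow hr (by norm_num)).trans ?_
  rw [ENNReal.ofReal_rpow_of_nonneg hc (by norm_num), Real.sqrt_eq_rpow]

end Descriptor

/-! ### Consequences for the descriptor system -/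

namespace Descriptor

variable {n q p r : ℕ} {m : Type*} [Fintype m]

lemma complex_dissipation_descriptor {L : Matrix (Fin r) (Fin r) ℝ} (hL : L.PosDef)
    {E A : Matrix (Fin n) (Fin n) ℝ} {B : Matrix (Fin n) (Fin q) ℝ}
    {C : Matrix (Fin p) (Fin n) ℝ} {D : Matrix (Fin p) (Fin q) ℝ} {γ d : ℝ}
    {W : Matrix (Fin r ⊕ m) (Fin n) ℝ} {V : Matrix (Fin n) (Fin r ⊕ m) ℝ}
    {V' : Matrix (Fin r ⊕ m) (Fin n) ℝ} (hV : V * V' = 1)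
    (hWEV : W * E * V = Matrix.fromBlocks 1 0 0 0)
    (h : ∀ (x : Fin r ⊕ m → ℝ) (w : Fin q → ℝ) (u : Fin r → ℝ),
      (W * A * V) *ᵥ x + (W * B) *ᵥ w = Sum.elim u 0 →
      ∀ y : Fin p → ℝ, y = (C * V) *ᵥ x + D *ᵥ w →
        u ⬝ᵥ L *ᵥ u + y ⬝ᵥ y + d * (x ⬝ᵥ x + w ⬝ᵥ w) ≤
          (x ∘ Sum.inl) ⬝ᵥ L *ᵥ (x ∘ Sum.inl) + γ ^ 2 * (w ⬝ᵥ w))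
    {z : ℂ} (hz : 1 ≤ ‖z‖) (x : Fin n → ℂ) (w : Fin q → ℂ)
    (hx : pencil E A z *ᵥ x = toC B *ᵥ w) :
    ∑ i, ‖(toC C *ᵥ x + toC D *ᵥ w) i‖ ^ 2
        + d * (∑ i, ‖(toC V' *ᵥ x) i‖ ^ 2 + ∑ i, ‖w i‖ ^ 2) ≤
      γ ^ 2 * ∑ i, ‖w i‖ ^ 2 := by
  have hVx : toC V *ᵥ (toC V' *ᵥ x) = x := by
    rw [Matrix.mulVec_mulVec, ← toC_mul, hV, toC_one, Matrix.one_mulVec]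
  have hJ : ∀ v : Fin r ⊕ m → ℂ, toC (W * E * V) *ᵥ v = Sum.elim (v ∘ Sum.inl) 0 := fun v => by
    rw [hWEV]
    simp [toC, Matrix.fromBlocks_map, Matrix.fromBlocks_mulVec]
  have h1 := complex_dissipation hL h hz (toC V' *ᵥ x) w (by
    rw [← hJ]
    simp only [toC_mul, ← Matrix.mulVec_mulVec, hVx, ← hx, pencil, Matrix.sub_mulVec,
      Matrix.smul_mulVec, Matrix.mulVec_sub, Matrix.mulVec_smul]
    abel)
  rwa [toC_mul, ← Matrix.mulVec_mulVec, hVx] at h1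

/-- A kernel vector `v` of `A₂₂` would give the admissible data `x = (0, v)`, `w = 0`, `u = A₁₂ v`.
The right side of the dissipation inequality then vanishes, while the left is at least `d|v|² > 0`.
-/
lemma toBlocks₂₂_det_ne_zero [DecidableEq m] {L : Matrix (Fin r) (Fin r) ℝ} (hL : L.PosDef)
    {A : Matrix (Fin r ⊕ m) (Fin r ⊕ m) ℝ} {B : Matrix (Fin r ⊕ m) (Fin q) ℝ}
    {C : Matrix (Fin p) (Fin r ⊕ m) ℝ} {D : Matrix (Fin p) (Fin q) ℝ} {γ d : ℝ} (hd : 0 < d)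
    (h : ∀ (x : Fin r ⊕ m → ℝ) (w : Fin q → ℝ) (u : Fin r → ℝ),
      A *ᵥ x + B *ᵥ w = Sum.elim u 0 → ∀ y : Fin p → ℝ, y = C *ᵥ x + D *ᵥ w →
        u ⬝ᵥ L *ᵥ u + y ⬝ᵥ y + d * (x ⬝ᵥ x + w ⬝ᵥ w) ≤
          (x ∘ Sum.inl) ⬝ᵥ L *ᵥ (x ∘ Sum.inl) + γ ^ 2 * (w ⬝ᵥ w)) :
    A.toBlocks₂₂.det ≠ 0 := by
  intro h0
  obtain ⟨v, hv, hv0⟩ := Matrix.exists_mulVec_eq_zero_iff.2 h0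
  have h1 := h (Sum.elim 0 v) 0 (A.toBlocks₁₂ *ᵥ v) (by
    conv_lhs => rw [← Matrix.fromBlocks_toBlocks A]
    simp [Matrix.fromBlocks_mulVec, hv0]) _ rfl
  simp only [sumElim_dotProduct_sumElim, Sum.elim_comp_inl, Matrix.mulVec_zero, add_zero,
    dotProduct_zero, zero_add, mul_zero] at h1
  have h2 : 0 ≤ A.toBlocks₁₂ *ᵥ v ⬝ᵥ L *ᵥ A.toBlocks₁₂ *ᵥ v := by
    simpa using hL.posSemidef.dotProduct_mulVec_nonneg (A.toBlocks₁₂ *ᵥ v)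
  have h3 : 0 ≤ C *ᵥ Sum.elim 0 v ⬝ᵥ C *ᵥ Sum.elim 0 v := by
    simpa using dotProduct_star_self_nonneg (C *ᵥ Sum.elim 0 v)
  have h4 : 0 < v ⬝ᵥ v := by simpa using Matrix.dotProduct_star_self_pos_iff.2 hv
  have h5 := mul_pos hd h4
  linarith

end Descriptor

theorem theorem1 {n q p s r : ℕ} (sys : UncertainDescriptorSystem n q p s)
    (hrank : sys.E.rank = r) (hrn : r < n)
    (W : Matrix (Fin r ⊕ Fin (n - r)) (Fin n) ℝ) (V : Matrix (Fin n) (Fin r ⊕ Fin (n - r)) ℝ)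
    (hW : Descriptor.IsNonsingular W) (hV : Descriptor.IsNonsingular V)
    (hWEV : W * sys.E * V = Matrix.fromBlocks 1 0 0 0)
    (γ : ℝ) (hγ : 0 < γ)
    (hLMI : ∃ (ε : ℝ) (L Q : Matrix (Fin r) (Fin r) ℝ) (R : Matrix (Fin r) (Fin (n - r)) ℝ)
      (S : Matrix (Fin (n - r)) (Fin (n - r)) ℝ),
      0 < ε ∧ L.PosDef ∧ Descriptor.IsNegDef (Descriptor.lmiMat sys W V γ ε L Q R S)) :
    ∀ Δ : Matrix (Fin s) (Fin s) ℝ, (1 - Δᵀ * Δ).PosSemidef →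
      Descriptor.IsAdmissible sys.E (sys.AΔ Δ) ∧
      Descriptor.hInfNorm (Descriptor.transferFunction sys.E (sys.AΔ Δ) (sys.BΔ Δ) (sys.CΔ Δ)
        (sys.DΔ Δ)) < ENNReal.ofReal γ := by
  intro Δ hΔ
  obtain ⟨ε, L, Q, R, S, hε, hL, hneg⟩ := hLMI
  obtain ⟨d, hd, hdis⟩ := Descriptor.dissipation hε hneg
  have hreal := hdis Δ hΔ
  obtain ⟨V', hVV', hV'V⟩ := id hV
  have key := fun z hz => Descriptor.complex_dissipation_descriptor hL hVV' hWEV hreal (z := z) hz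
  have hdet : ∀ z : ℂ, 1 ≤ ‖z‖ → (Descriptor.pencil sys.E (sys.AΔ Δ) z).det ≠ 0 := by
    intro z hz h0
    obtain ⟨v, hv, hv0⟩ := Matrix.exists_mulVec_eq_zero_iff.2 h0
    have h1 := key z hz v 0 (by rw [hv0, Matrix.mulVec_zero])
    have hne : Descriptor.toC V' *ᵥ v ≠ 0 := fun h => hv (by
      rw [← Matrix.one_mulVec v, ← Descriptor.toC_one, ← hVV', Descriptor.toC_mul,
        ← Matrix.mulVec_mulVec, h, Matrix.mulVec_zero])
    have h2 := mul_pos hd (Descriptor.sum_norm_sq_pos hne)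
    have h3 : 0 ≤ ∑ i, ‖(Descriptor.toC (sys.CΔ Δ) *ᵥ v
        + Descriptor.toC (sys.DΔ Δ) *ᵥ 0) i‖ ^ 2 :=
      Finset.sum_nonneg fun _ _ => by positivity
    simp only [Pi.zero_apply, norm_zero, ne_eq, OfNat.ofNat_ne_zero, not_false_eq_true,
      zero_pow, Finset.sum_const_zero, add_zero, mul_zero] at h1
    linarith
  have hdeg : (Descriptor.charPoly sys.E (sys.AΔ Δ)).degree = r :=
    Descriptor.degree_charPoly hW hV hWEV (Descriptor.toBlocks₂₂_det_ne_zero hL hd hreal)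
  refine ⟨⟨⟨1, hdet 1 (by simp)⟩, ?_, ?_⟩, ?_⟩
  · rw [Descriptor.IsCausal, hdeg, hrank]
  · refine Descriptor.isStable_of_norm_lt_one (fun h => ?_) fun z hz => ?_
    · simp [h] at hdeg
    · by_contra! hz1
      exact hdet z hz1 hz
  -- The maximum with `0` supplies the nonnegative gain constant that `maxSingularValue_le` needs,
  -- since no bound `d ≤ γ²` is at hand.
  have hlt : Real.sqrt (max 0 (γ ^ 2 - d)) < γ := by
    rw [Real.sqrt_lt' hγ]
    exact max_lt (by positivity) (by linarith)
  refine lt_of_le_of_lt (iSup₂_le fun z hz => ?_) ((ENNReal.ofReal_lt_ofReal_iff hγ).2 hlt)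
  have hz1 : 1 ≤ ‖z‖ := le_of_lt hz
  refine Descriptor.maxSingularValue_le (le_max_left _ _) fun w => ?_
  have hu : IsUnit (Descriptor.pencil sys.E (sys.AΔ Δ) z).det := (hdet z hz1).isUnit
  have h1 := key z hz1 ((Descriptor.pencil sys.E (sys.AΔ Δ) z)⁻¹ *ᵥ
    (Descriptor.toC (sys.BΔ Δ) *ᵥ w)) w (by
      rw [Matrix.mulVec_mulVec, Matrix.mul_nonsing_inv _ hu, Matrix.one_mulVec])
  rw [Descriptor.transferFunction, Matrix.add_mulVec, ← Matrix.mulVec_mulVec,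
    ← Matrix.mulVec_mulVec]
  have h2 : 0 ≤ d * ∑ i, ‖(Descriptor.toC V' *ᵥ ((Descriptor.pencil sys.E (sys.AΔ Δ) z)⁻¹ *ᵥ
      (Descriptor.toC (sys.BΔ Δ) *ᵥ w))) i‖ ^ 2 :=
    mul_nonneg hd.le (Finset.sum_nonneg fun _ _ => by positivity)
  have h3 : (γ ^ 2 - d) * ∑ i, ‖w i‖ ^ 2 ≤ max 0 (γ ^ 2 - d) * ∑ i, ‖w i‖ ^ 2 :=
    mul_le_mul_of_nonneg_right (le_max_right _ _)
      (Finset.sum_nonneg fun _ _ => by positivity)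
  linarith
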